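/- Let $n\ge 1$, $\hbar>0$, and let $V$ be a real polynomial in $n$ variables of degree $\mu\ge 1$ with $V(k)\ge 0$ for all $k\in\hbar\mathbb{Z}^n$. If $n\ge 2$, assume moreover that $V$ is elliptic of order $\mu$: there are $c,M>0$ such that $|V(k)|\ge c\,(1+|k|)^{\mu}$ for all $k\in\hbar\mathbb{Z}^n$ with $|k|\ge M$ (for $n=1$ this holds automatically). Let $$(H_{\hbar,V}f)(k)=-\hbar^{-2}\sum_{j=1}^{n}\bigl(f(k+\hbar e_j)-2f(k)+f(k-\hbar e_j)\bigr)+V(k)f(k),\qquad k\in\hbar\mathbb{Z}^n,$$ be the discrete Schrödinger operator in $\ell^2(\hbar\mathbb{Z}^n)$ with domain $\{u\in\ell^2(\hbar\mathbb{Z}^n): H_{\hbar,V}u\in\ell^2(\hbar\mathbb{Z}^n)\}$. For $0<r\le 1$, a bounded operator $A$ on $\ell^2(\hbar\mathbb{Z}^n)$ is called $r$-nuclear if there are $g_m,h_m\in\ell^2(\hbar\mathbb{Z}^n)$, $m\in\mathbb N$, with $\sum_m\|g_m\|^r\|h_m\|^r<\infty$ and $(Af)(k)=\sum_{l}\bigl(\sum_m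 g_m(k)h_m(l)\bigr)f(l)$ for all $f\in\ell^2(\hbar\mathbb{Z}^n)$ and all $k$. Then: 1. There exists $\lambda>0$ such that $H_{\hbar,V}+\lambda I$ maps its domain bijectively onto $\ell^2(\hbar\mathbb{Z}^n)$, with a bounded inverse $(H_{\hbar,V}+\lambda I)^{-1}$ that is $r$-nuclear for every $r$ with $\frac{n}{\mu}<r\le 1$. 2. The eigenvalues of $H_{\hbar,V}$ are real, have finite multiplicity, and, repeated according to multiplicity, can be enumerated as a nondecreasing sequence $\lambda_1\le\lambda_2\le\dots$; for every $r$ with $\frac{n}{\mu}<r\le 1$ there is a constant $C>0$ such that $C\,j^{1/r}\le\lambda_j$ for all sufficiently large $j$. In particular, for $n=1$ both conclusions hold for every $r$ with $\frac1\mu<r\le1$. -/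

import Mathlib

noncomputable section

/-- The point `k = ħ m` of the lattice `ħℤⁿ ⊂ ℝⁿ`, for `m ∈ ℤⁿ`. As `ħ > 0`, the map `m ↦ ħ m` is
a bijection of `ℤⁿ` onto `ħℤⁿ`; functions on `ħℤⁿ` are written below as functions of `m`. -/
def latticePoint {n : ℕ} (hbar : ℝ) (m : Fin n → ℤ) : EuclideanSpace ℝ (Fin n) :=
  WithLp.toLp 2 fun i => hbar * (m i : ℝ)

/-- The value `V(k)` of the polynomial `V` at the lattice point `k = ħ m`. -/
def potential {n : ℕ} (hbar : ℝ) (V : MvPolynomial (Fin n) ℝ) (m : Fin n → ℤ) : ℝ :=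
  MvPolynomial.eval (fun i => latticePoint hbar m i) V

/-- `V` is elliptic of order `μ` on `ħℤⁿ`: `|V(k)| ≥ C (1 + |k|) ^ μ` for all `k ∈ ħℤⁿ` with
`|k| ≥ M`, where `|k|` is the Euclidean norm. -/
def IsEllipticPotential {n : ℕ} (hbar : ℝ) (V : MvPolynomial (Fin n) ℝ) (μ : ℕ) : Prop :=
  ∃ C > (0 : ℝ), ∃ M > (0 : ℝ), ∀ m : Fin n → ℤ, M ≤ ‖latticePoint hbar m‖ →
    C * (1 + ‖latticePoint hbar m‖) ^ μ ≤ |potential hbar V m|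

/-- The discrete Laplacian `(Δ f)(k) = ∑ⱼ (f(k + ħ eⱼ) - 2 f(k) + f(k - ħ eⱼ))`. -/
def discreteLaplacian (n : ℕ) : ((Fin n → ℤ) → ℂ) →ₗ[ℂ] ((Fin n → ℤ) → ℂ) where
  toFun f m := ∑ i : Fin n, (f (m + Pi.single i 1) - 2 * f m + f (m - Pi.single i 1))
  map_add' f g := by
    funext m
    simp only [Pi.add_apply, ← Finset.sum_add_distrib]
    exact Finset.sum_congr rfl fun i _ => by ring
  map_smul' c f := by
    funext m
    simp only [Pi.smul_apply, smul_eq_mul, RingHom.id_apply, Finset.mul_sum]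
    exact Finset.sum_congr rfl fun i _ => by ring

/-- The formal action `(H f)(k) = -ħ⁻² (Δ f)(k) + V(k) f(k)` on all functions on `ħℤⁿ`. -/
def formalSchrodinger {n : ℕ} (hbar : ℝ) (V : MvPolynomial (Fin n) ℝ) :
    ((Fin n → ℤ) → ℂ) →ₗ[ℂ] ((Fin n → ℤ) → ℂ) where
  toFun f m := -((hbar ^ 2 : ℝ) : ℂ)⁻¹ * discreteLaplacian n f m + (potential hbar V m : ℂ) * f m
  map_add' f g := by
    funext m
    simp only [map_add, Pi.add_apply]
    ring
  map_smul' c f := by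
    funext m
    simp only [map_smul, Pi.smul_apply, smul_eq_mul, RingHom.id_apply]
    ring

/-- The Hilbert space `ℓ²(ħℤⁿ)` of complex-valued functions. -/
abbrev LatticeL2 (n : ℕ) : Type := lp (fun _ : Fin n → ℤ => ℂ) 2

/-- The discrete Schrödinger operator `H = -ħ⁻² Δ + V` as an unbounded operator in `ℓ²(ħℤⁿ)`, on
its maximal domain `{u ∈ ℓ² : H u ∈ ℓ²}` (which is also `{u ∈ ℓ² : (H + I) u ∈ ℓ²}`). -/
def schrodinger {n : ℕ} (hbar : ℝ) (V : MvPolynomial (Fin n) ℝ) :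
    LatticeL2 n →ₗ.[ℂ] LatticeL2 n where
  domain :=
    { carrier := {u | Memℓp (formalSchrodinger hbar V (u : (Fin n → ℤ) → ℂ)) 2}
      add_mem' := by
        intro u v hu hv
        simp only [Set.mem_ofPred_eq, lp.coeFn_add, map_add] at hu hv ⊢
        exact hu.add hv
      zero_mem' := by
        simp only [Set.mem_ofPred_eq, lp.coeFn_zero, map_zero]
        exact zero_memℓp
      smul_mem' := by
        intro c u hu
        simp only [Set.mem_ofPred_eq, lp.coeFn_smul, map_smul] at hu ⊢
        exact hu.const_smul c }
  toFun :=
    { toFun := fun u => ⟨formalSchrodinger hbar V ((u : LatticeL2 n) : (Fin n → ℤ) → ℂ), u.2⟩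
      map_add' := by
        intro u v
        apply lp.ext
        simp only [Submodule.coe_add, lp.coeFn_add, map_add]
      map_smul' := by
        intro c u
        apply lp.ext
        simp only [Submodule.coe_smul, lp.coeFn_smul, map_smul, RingHom.id_apply] }

/-- The bounded operator `R` is the inverse `(H + z I)⁻¹` of `H + z I : Dom H → ℓ²`. -/
def IsShiftedInverse {n : ℕ} (H : LatticeL2 n →ₗ.[ℂ] LatticeL2 n) (z : ℂ)
    (R : LatticeL2 n →L[ℂ] LatticeL2 n) : Prop :=
  (∀ f : LatticeL2 n, ∃ u : H.domain, (u : LatticeL2 n) = R f ∧ H u + z • (u : LatticeL2 n) = f) ∧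
  ∀ u : H.domain, R (H u + z • (u : LatticeL2 n)) = u

/-- `A` is an `r`-nuclear operator on `ℓ²(ħℤⁿ)`: there are `g_m, h_m ∈ ℓ²` with
`(A f)(k) = ∑_l (∑_m g_m(k) h_m(l)) f(l)` and `∑_m ‖g_m‖^r ‖h_m‖^r < ∞`. -/
def IsRNuclear {n : ℕ} (r : ℝ) (A : LatticeL2 n →L[ℂ] LatticeL2 n) : Prop :=
  0 < r ∧ r ≤ 1 ∧ ∃ g h : ℕ → LatticeL2 n,
    Summable (fun m => ‖g m‖ ^ r * ‖h m‖ ^ r) ∧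
    ∀ (f : LatticeL2 n) (k : Fin n → ℤ),
      HasSum (fun l : Fin n → ℤ => (∑' m, g m k * h m l) * f l) (A f k)

/-- The eigenspace `{u ∈ Dom H : H u = z u}`. -/
def unboundedEigenspace {n : ℕ} (H : LatticeL2 n →ₗ.[ℂ] LatticeL2 n) (z : ℂ) :
    Submodule ℂ H.domain :=
  LinearMap.ker (H.toFun - z • H.domain.subtype)

/-- `ev 0 ≤ ev 1 ≤ …` is the nondecreasing enumeration of all eigenvalues of `H`, each one repeated
according to its (finite) multiplicity. -/
def IsEigenvalueEnumeration {n : ℕ} (H : LatticeL2 n →ₗ.[ℂ] LatticeL2 n) (ev : ℕ → ℝ) : Prop :=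
  Monotone ev ∧ ∀ z : ℂ, FiniteDimensional ℂ (unboundedEigenspace H z) ∧
    {j : ℕ | (ev j : ℂ) = z}.encard = (Module.finrank ℂ (unboundedEigenspace H z) : ℕ∞)

end

open scoped ENNReal ComplexInnerProductSpace

/-! ### Multiplication and permutation operators on ℓ². -/

noncomputable section

/-! Write B = -ħ⁻²Δ and D = (V + λ)⁻¹. On the lattice B is bounded, and it is nonnegative as a sum
of squares. Since H + λ = (1 + B D)(V + λ), choosing λ > ‖B‖ makes 1 + B D invertible by a Neumann
series, and the resolvent is R = D (1 + B D)⁻¹ (`exists_isShiftedInverse`).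

The left factor D carries the decay. It is diagonal with entries O((1 + |k|)^(-μ)), whose r-th
powers are summable when μ r > n; this gives nuclearity of D T for every bounded T. Also D is
compact, so R is compact, injective and symmetric, and the spectral theorem supplies finite
multiplicities and infinitely many orthonormal eigenvectors.

The eigenvalue bound does not go through nuclearity. As B ≥ 0, a variational comparison
(`ncard_eigenvalue_le`) bounds the number of eigenvalues ≤ E by the number of sites with V ≤ E,
which is O((E + K)^(n/μ)). Taking E = λ_j gives growth of order j^(μ/n), and 1/r < μ/n.
Polynomiality of V is used only to get ellipticity when n = 1. -/

lemma lp_norm_le_mul_norm {α : Type*} {f g : lp (fun _ : α => ℂ) 2} {C : ℝ} (hC : 0 ≤ C)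
    (h : ∀ i, ‖f i‖ ≤ C * ‖g i‖) : ‖f‖ ≤ C * ‖g‖ := by
  have hg : ‖(C : ℂ) • g‖ = C * ‖g‖ := by
    rw [norm_smul, Complex.norm_real, Real.norm_of_nonneg hC]
  rw [← hg]
  refine lp.norm_mono (by norm_num) fun i => (h i).trans (le_of_eq ?_)
  rw [lp.coeFn_smul, Pi.smul_apply, norm_smul, Complex.norm_real, Real.norm_of_nonneg hC]

/-- Multiplication by a bounded function, as a bounded operator on `ℓ²`. -/
def lpMul {α : Type*} (a : α → ℂ) (C : ℝ) (hC : 0 ≤ C) (ha : ∀ i, ‖a i‖ ≤ C) :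
    lp (fun _ : α => ℂ) 2 →L[ℂ] lp (fun _ : α => ℂ) 2 :=
  LinearMap.mkContinuous
    { toFun := fun f => ⟨fun i => a i * f i, Memℓp.mono' (g := (C : ℂ) • (f : α → ℂ))
        ((lp.memℓp f).const_smul _) fun i => by
          simpa [abs_of_nonneg hC] using mul_le_mul_of_nonneg_right (ha i) (norm_nonneg (f i))⟩
      map_add' := fun f g => by
        apply lp.ext
        funext i
        exact mul_add _ _ _
      map_smul' := fun c f => by
        apply lp.ext
        funext i
        exact mul_left_comm _ _ _ } C fun f =>
    lp_norm_le_mul_norm hC fun i => by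
      simpa using mul_le_mul_of_nonneg_right (ha i) (norm_nonneg (f i))

section LpMul

variable {α : Type*} {a : α → ℂ} {C : ℝ} {hC : 0 ≤ C} {ha : ∀ i, ‖a i‖ ≤ C}

@[simp]
lemma lpMul_apply (f : lp (fun _ : α => ℂ) 2) (i : α) : lpMul a C hC ha f i = a i * f i := rfl

lemma norm_lpMul_le : ‖lpMul a C hC ha‖ ≤ C :=
  LinearMap.mkContinuous_norm_le _ hC _

lemma isSelfAdjoint_lpMul (h : ∀ i, star (a i) = a i) : IsSelfAdjoint (lpMul a C hC ha) := by
  rw [ContinuousLinearMap.isSelfAdjoint_iff_isSymmetric]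
  intro f g
  change ⟪lpMul a C hC ha f, g⟫ = ⟪f, lpMul a C hC ha g⟫
  rw [lp.inner_eq_tsum, lp.inner_eq_tsum]
  refine tsum_congr fun i => ?_
  have := h i
  simp only [lpMul_apply, RCLike.inner_apply, map_mul, starRingEnd_apply, this]
  ring

-- Truncations to finite sets of sites have finite rank and converge in operator norm, because only
-- finitely many entries exceed a given size.
open Filter Topology in
lemma isCompactOperator_lpMul (h : Tendsto a cofinite (𝓝 0)) :
    IsCompactOperator (lpMul a C hC ha) := by
  classical
  let F : Finset α → lp (fun _ : α => ℂ) 2 →L[ℂ] lp (fun _ : α => ℂ) 2 := fun s =>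
    ∑ i ∈ s, (lp.singleContinuousLinearMap ℂ (fun _ : α => ℂ) 2 i).comp
      (a i • lp.evalCLM ℂ (fun _ : α => ℂ) 2 i)
  have hF : ∀ s f i, F s f i = if i ∈ s then a i * f i else 0 := by
    intro s f i
    simp only [F, sum_apply, lp.coeFn_sum, Finset.sum_apply]
    simp [lp.single_apply, Pi.single_apply]
    rfl
  refine isCompactOperator_of_tendsto (l := atTop) (F := F) ?_ (Eventually.of_forall fun s => ?_)
  · rw [Metric.tendsto_nhds]
    intro ε hε
    have hfin : {i | ¬ ‖a i‖ < ε / 2}.Finite := by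
      have h' : Tendsto (fun i => ‖a i‖) cofinite (𝓝 0) := by simpa using h.norm
      exact h'.eventually (gt_mem_nhds (half_pos hε))
    filter_upwards [eventually_ge_atTop hfin.toFinset] with s hs
    rw [dist_eq_norm]
    refine lt_of_le_of_lt (ContinuousLinearMap.opNorm_le_bound _ (half_pos hε).le fun f => ?_)
      (half_lt_self hε)
    refine lp_norm_le_mul_norm (half_pos hε).le fun i => ?_
    simp only [sub_apply, lp.coeFn_sub, Pi.sub_apply, hF, lpMul_apply]
    split_ifs with hi
    · simp
      positivity
    · have : ‖a i‖ < ε / 2 := by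
        by_contra hcon
        exact hi (hs (by simpa using hcon))
      rw [zero_sub, norm_neg, norm_mul]
      gcongr
  · have : F s ∈
        compactOperator (RingHom.id ℂ) (lp (fun _ : α => ℂ) 2) (lp (fun _ : α => ℂ) 2) :=
      Submodule.sum_mem _ fun i _ =>
        (isCompactOperator_of_locallyCompactSpace_dom
          (a i • lp.evalCLM ℂ (fun _ : α => ℂ) 2 i)).clm_comp
          (lp.singleContinuousLinearMap ℂ (fun _ : α => ℂ) 2 i)
    exact this

end LpMul

/-- Composition with a permutation, as a bounded operator on `ℓ²`. -/
def lpComp {α : Type*} (e : Equiv.Perm α) :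
    lp (fun _ : α => ℂ) 2 →L[ℂ] lp (fun _ : α => ℂ) 2 :=
  LinearMap.mkContinuous
    { toFun := fun f => ⟨fun i => f (e i), memℓp_gen
        (e.summable_iff.2 ((lp.memℓp f).summable (by norm_num)))⟩
      map_add' := fun f g => rfl
      map_smul' := fun c f => rfl } 1 fun f => by
    rw [one_mul]
    refine le_of_eq ?_
    rw [lp.norm_eq_tsum_rpow (by norm_num), lp.norm_eq_tsum_rpow (by norm_num)]
    congr 1
    exact e.tsum_eq (fun i => ‖f i‖ ^ (2 : ℝ≥0∞).toReal)

section LpComp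

variable {α : Type*} (e : Equiv.Perm α)

@[simp]
lemma lpComp_apply (f : lp (fun _ : α => ℂ) 2) (i : α) : lpComp e f i = f (e i) := rfl

lemma lpComp_symm_comp : lpComp e.symm * lpComp e = 1 := by
  ext f i
  change f (e (e.symm i)) = f i
  rw [e.apply_symm_apply]

lemma star_lpComp : star (lpComp e) = lpComp e.symm := by
  rw [ContinuousLinearMap.star_eq_adjoint]
  symm
  rw [ContinuousLinearMap.eq_adjoint_iff]
  intro f g
  rw [lp.inner_eq_tsum, lp.inner_eq_tsum]
  rw [← e.tsum_eq]
  simp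

end LpComp

/-! ### The kinetic term and the energy inequality. -/

section Kinetic

variable {n : ℕ} (hbar : ℝ)

/-- The bounded operator `-ħ⁻² Δ` on `ℓ²(ħℤⁿ)`, written as `ħ⁻² ∑ⱼ (Sⱼ - 1)⋆ (Sⱼ - 1)` in terms of
the shifts `Sⱼ`. -/
def kinetic (n : ℕ) (hbar : ℝ) : LatticeL2 n →L[ℂ] LatticeL2 n :=
  ((hbar ^ 2)⁻¹ : ℝ) • ∑ i : Fin n,
    star (lpComp (Equiv.addRight (Pi.single i 1 : Fin n → ℤ)) - 1) *
      (lpComp (Equiv.addRight (Pi.single i 1 : Fin n → ℤ)) - 1)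

/-- Each shift S is unitary, so (S - 1)⋆(S - 1) = 2 - S - S⁻¹. -/
lemma kinetic_apply (f : LatticeL2 n) (m : Fin n → ℤ) :
    kinetic n hbar f m = -((hbar ^ 2 : ℝ) : ℂ)⁻¹ * discreteLaplacian n f m := by
  have h : ∀ i : Fin n, star (lpComp (Equiv.addRight (Pi.single i 1 : Fin n → ℤ)) - 1) *
      (lpComp (Equiv.addRight (Pi.single i 1 : Fin n → ℤ)) - 1) =
      (2 : ℂ) • 1 - lpComp (Equiv.addRight (Pi.single i 1 : Fin n → ℤ)) -
        lpComp (Equiv.addRight (Pi.single i 1 : Fin n → ℤ)).symm := by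
    intro i
    rw [star_sub, star_one, sub_mul, mul_sub, star_lpComp, lpComp_symm_comp, two_smul]
    noncomm_ring
  simp only [kinetic, h, smul_apply, sum_apply, lp.coeFn_smul, lp.coeFn_sum, Pi.smul_apply,
    Finset.sum_apply, discreteLaplacian, LinearMap.coe_mk, AddHom.coe_mk, sub_apply,
    lp.coeFn_sub, Pi.sub_apply, lpComp_apply, Equiv.coe_addRight, one_apply_eq_self,
    Equiv.addRight_symm, smul_eq_mul, ← sub_eq_add_neg]
  rw [Complex.real_smul, Complex.ofReal_inv, neg_mul, ← mul_neg, ← Finset.sum_neg_distrib]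
  congr 1
  exact Finset.sum_congr rfl fun i _ => by ring

lemma isSelfAdjoint_kinetic : IsSelfAdjoint (kinetic n hbar) := by
  rw [kinetic, RCLike.real_smul_eq_coe_smul (K := ℂ)]
  refine IsSelfAdjoint.smul (Complex.conj_ofReal _) ?_
  exact isSelfAdjoint_sum _ fun i _ => IsSelfAdjoint.star_mul_self _

lemma re_inner_kinetic_nonneg (f : LatticeL2 n) : 0 ≤ (⟪f, kinetic n hbar f⟫).re := by
  simp only [kinetic, smul_apply, sum_apply, inner_smul_right_eq_smul, inner_sum]
  rw [Complex.smul_re, Complex.re_sum]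
  refine smul_nonneg (by positivity) (Finset.sum_nonneg fun i _ => ?_)
  rw [mul_apply_eq_comp, ContinuousLinearMap.star_eq_adjoint,
    ContinuousLinearMap.adjoint_inner_right]
  exact inner_self_nonneg (𝕜 := ℂ)

/-- A function concentrated where `V > E` has energy greater than `E`. -/
lemma eq_zero_of_re_inner_le {W : (Fin n → ℤ) → ℝ} {E : ℝ} {x y : LatticeL2 n}
    (hxy : ∀ m, y m = kinetic n hbar x m + W m * x m) (hx : ∀ m, W m ≤ E → x m = 0)
    (hE : (⟪x, y⟫).re ≤ E * ‖x‖ ^ 2) : x = 0 := by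
  have h1 : HasSum (fun m => (⟪x m, (y - kinetic n hbar x) m⟫).re)
      (⟪x, y - kinetic n hbar x⟫).re :=
    (Complex.hasSum_iff _ _).1 (lp.hasSum_inner x (y - kinetic n hbar x)) |>.1
  have h2 : HasSum (fun m => E * ‖x m‖ ^ 2) (E * ‖x‖ ^ 2) := by
    have := lp.hasSum_norm (p := 2) (by norm_num) x
    simp only [ENNReal.toReal_ofNat, Real.rpow_ofNat] at this
    exact this.mul_left E
  have h3 := h1.sub h2
  have h4 : ∀ m, (⟪x m, (y - kinetic n hbar x) m⟫).re - E * ‖x m‖ ^ 2 =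
      (W m - E) * ‖x m‖ ^ 2 := by
    intro m
    rw [lp.coeFn_sub, Pi.sub_apply, hxy, add_sub_cancel_left, RCLike.inner_apply, mul_assoc,
      Complex.mul_conj, ← Complex.ofReal_mul, Complex.ofReal_re, Complex.normSq_eq_norm_sq]
    ring
  simp only [h4] at h3
  have h5 : ∀ m, 0 ≤ (W m - E) * ‖x m‖ ^ 2 := by
    intro m
    by_cases hm : W m ≤ E
    · simp [hx m hm]
    · exact mul_nonneg (by linarith) (by positivity)
  -- Since B ≥ 0, the sum of (W - E)|x|² is at most zero; its terms are nonnegative, so all of them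
  -- vanish.
  have h6 : (⟪x, y - kinetic n hbar x⟫).re - E * ‖x‖ ^ 2 ≤ 0 := by
    rw [inner_sub_right, Complex.sub_re]
    linarith [re_inner_kinetic_nonneg hbar x]
  have h7 : (⟪x, y - kinetic n hbar x⟫).re - E * ‖x‖ ^ 2 = 0 := le_antisymm h6 (h3.nonneg h5)
  rw [h7, hasSum_zero_iff_of_nonneg h5] at h3
  apply lp.ext
  funext m
  by_cases hm : W m ≤ E
  · exact hx m hm
  · have := congrFun h3 m
    simpa [sub_ne_zero.2 (ne_of_gt (not_le.1 hm))] using this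

end Kinetic

/-! ### Construction of the resolvent. -/

section Resolvent

variable {n : ℕ} {hbar : ℝ} {V : MvPolynomial (Fin n) ℝ}

lemma formalSchrodinger_apply (f : LatticeL2 n) (m : Fin n → ℤ) :
    formalSchrodinger hbar V f m = kinetic n hbar f m + potential hbar V m * f m := by
  rw [kinetic_apply]
  rfl

lemma schrodinger_coe (u : (schrodinger hbar V).domain) :
    ((schrodinger hbar V u : LatticeL2 n) : (Fin n → ℤ) → ℂ) =
      formalSchrodinger hbar V (u : LatticeL2 n) := rfl

lemma mem_schrodinger_domain {u : LatticeL2 n} : u ∈ (schrodinger hbar V).domain ↔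
    Memℓp (formalSchrodinger hbar V (u : (Fin n → ℤ) → ℂ)) 2 := Iff.rfl

/-- If `H u + z u = w` holds pointwise with `u` and `w` in `ℓ²`, then `u` is in the domain. -/
lemma exists_domain_of_forall_apply {u w : LatticeL2 n} {z : ℂ}
    (h : ∀ m, formalSchrodinger hbar V u m + z * u m = w m) :
    ∃ v : (schrodinger hbar V).domain, (v : LatticeL2 n) = u ∧
      schrodinger hbar V v + z • (v : LatticeL2 n) = w := by
  have hd : formalSchrodinger hbar V u = ((w - z • u : LatticeL2 n) : (Fin n → ℤ) → ℂ) := by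
    funext m
    rw [lp.coeFn_sub, lp.coeFn_smul, Pi.sub_apply, ← h]
    simp
  refine ⟨⟨u, mem_schrodinger_domain.2 (hd ▸ lp.memℓp _)⟩, rfl, lp.ext (funext fun m => ?_)⟩
  rw [lp.coeFn_add, lp.coeFn_smul, schrodinger_coe]
  exact h m

lemma norm_inv_potential_add_le (hV : ∀ m, 0 ≤ potential hbar V m) {lam : ℝ} (hlam : 0 < lam) (m : Fin n → ℤ) :
    ‖((potential hbar V m + lam : ℝ) : ℂ)⁻¹‖ ≤ lam⁻¹ := by
  rw [norm_inv, Complex.norm_real, Real.norm_of_nonneg (by linarith [hV m])]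
  exact inv_anti₀ hlam (by linarith [hV m])

/-- The bounded operator of multiplication by `(V + λ)⁻¹`. -/
def inversePotential (hV : ∀ m, 0 ≤ potential hbar V m) {lam : ℝ} (hlam : 0 < lam) :
    LatticeL2 n →L[ℂ] LatticeL2 n :=
  lpMul (fun m => ((potential hbar V m + lam : ℝ) : ℂ)⁻¹) lam⁻¹ (inv_nonneg.2 hlam.le)
    (norm_inv_potential_add_le hV hlam)

lemma inversePotential_apply (hV : ∀ m, 0 ≤ potential hbar V m) {lam : ℝ} (hlam : 0 < lam)
    (f : LatticeL2 n) (m : Fin n → ℤ) :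
    inversePotential hV hlam f m = ((potential hbar V m + lam : ℝ) : ℂ)⁻¹ * f m := rfl

lemma mul_inversePotential_apply (hV : ∀ m, 0 ≤ potential hbar V m) {lam : ℝ} (hlam : 0 < lam)
    (f : LatticeL2 n) (m : Fin n → ℤ) :
    ((potential hbar V m : ℂ) + lam) * inversePotential hV hlam f m = f m := by
  have : ((potential hbar V m + lam : ℝ) : ℂ) ≠ 0 :=
    Complex.ofReal_ne_zero.2 (by linarith [hV m])
  rw [inversePotential_apply, ← Complex.ofReal_add, mul_inv_cancel_left₀ this]

lemma isSelfAdjoint_inversePotential (hV : ∀ m, 0 ≤ potential hbar V m) {lam : ℝ}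
    (hlam : 0 < lam) : IsSelfAdjoint (inversePotential hV hlam) :=
  isSelfAdjoint_lpMul fun m => by
    rw [← Complex.ofReal_inv]
    exact Complex.conj_ofReal _

/-- The energy principle at level E = -λ: no site has V ≤ -λ, so the vanishing condition is vacuous.
-/
lemma schrodinger_add_injective (hV : ∀ m, 0 ≤ potential hbar V m) {lam : ℝ} (hlam : 0 < lam)
    {u : (schrodinger hbar V).domain}
    (hu : schrodinger hbar V u + (lam : ℂ) • (u : LatticeL2 n) = 0) : u = 0 := by
  apply Subtype.ext
  refine eq_zero_of_re_inner_le hbar (W := potential hbar V) (E := -lam)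
    (y := schrodinger hbar V u) (fun m => formalSchrodinger_apply _ m)
    (fun m hm => absurd hm (by linarith [hV m])) ?_
  rw [eq_neg_of_add_eq_zero_left hu, inner_neg_right, inner_smul_right, Complex.neg_re,
    Complex.re_ofReal_mul, neg_mul]
  have : (⟪(u : LatticeL2 n), (u : LatticeL2 n)⟫).re = ‖(u : LatticeL2 n)‖ ^ 2 :=
    inner_self_eq_norm_sq (𝕜 := ℂ) _
  rw [this]

/-- The resolvent factors through multiplication by `(V + λ)⁻¹`. -/
lemma exists_isShiftedInverse (hV : ∀ m, 0 ≤ potential hbar V m) {lam : ℝ} (hlam : 0 < lam)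
    (hB : ‖kinetic n hbar‖ < lam) : ∃ T : LatticeL2 n →L[ℂ] LatticeL2 n,
      IsShiftedInverse (schrodinger hbar V) lam (inversePotential hV hlam * T) ∧
      (inversePotential hV hlam * T).IsSymmetric := by
  set D := inversePotential hV hlam with hD
  set B := kinetic n hbar with hB'
  have hnorm : ‖-(B * D)‖ < 1 := by
    rw [norm_neg]
    calc ‖B * D‖ ≤ ‖B‖ * lam⁻¹ := (norm_mul_le _ _).trans
          (mul_le_mul_of_nonneg_left norm_lpMul_le (norm_nonneg _))
      _ < lam * lam⁻¹ := by gcongr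
      _ = 1 := mul_inv_cancel₀ hlam.ne'
  let U := Units.oneSub (-(B * D)) hnorm
  have hU : (U : LatticeL2 n →L[ℂ] LatticeL2 n) = 1 + B * D := by
    simp [U]
  have hinv : ∀ f : LatticeL2 n, ∃ u : (schrodinger hbar V).domain,
      (u : LatticeL2 n) = (D * (↑U⁻¹ : LatticeL2 n →L[ℂ] LatticeL2 n)) f ∧
        schrodinger hbar V u + (lam : ℂ) • (u : LatticeL2 n) = f := by
    intro f
    have hf : (1 + B * D) ((↑U⁻¹ : LatticeL2 n →L[ℂ] LatticeL2 n) f) = f := by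
      rw [← hU, ← mul_apply_eq_comp, Units.mul_inv, one_apply_eq_self]
    -- (V + λ) D = 1 turns (H + λ) D U⁻¹ f into (1 + B D) U⁻¹ f = f.
    refine exists_domain_of_forall_apply fun m => ?_
    have hm := congrArg (fun g : LatticeL2 n => g m) hf
    simp only [add_apply, one_apply_eq_self, mul_apply_eq_comp, lp.coeFn_add, Pi.add_apply] at hm
    rw [formalSchrodinger_apply, mul_apply_eq_comp, add_assoc, ← add_mul,
      mul_inversePotential_apply, add_comm]
    exact hm
  refine ⟨(↑U⁻¹ : LatticeL2 n →L[ℂ] LatticeL2 n), ⟨hinv, fun u => ?_⟩, ?_⟩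
  · obtain ⟨v, hv, hvu⟩ := hinv (schrodinger hbar V u + (lam : ℂ) • (u : LatticeL2 n))
    rw [← hv]
    have : v - u = 0 := by
      refine schrodinger_add_injective hV hlam ?_
      rw [LinearPMap.map_sub, Submodule.coe_sub, smul_sub]
      rw [← sub_eq_zero] at hvu
      rw [← hvu]
      abel
    rw [sub_eq_zero.1 this]
  · rw [← ContinuousLinearMap.isSelfAdjoint_iff_isSymmetric]
    have hDs : star D = D := isSelfAdjoint_inversePotential hV hlam
    have hBs : star B = B := isSelfAdjoint_kinetic hbar
    -- Symmetry of D U⁻¹ comes from (1 + D B) D = D (1 + B D).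
    have hUs : star (U : LatticeL2 n →L[ℂ] LatticeL2 n) * D = D * U := by
      rw [hU, star_add, star_one, star_mul, hDs, hBs]
      noncomm_ring
    have h1 : star (↑U⁻¹ : LatticeL2 n →L[ℂ] LatticeL2 n) * star (U : LatticeL2 n →L[ℂ] LatticeL2 n)
        = 1 := by
      rw [← star_mul, Units.mul_inv, star_one]
    calc star (D * (↑U⁻¹ : LatticeL2 n →L[ℂ] LatticeL2 n))
        = star (↑U⁻¹ : LatticeL2 n →L[ℂ] LatticeL2 n) * (D * U) *
          (↑U⁻¹ : LatticeL2 n →L[ℂ] LatticeL2 n) := by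
          rw [star_mul, hDs, mul_assoc, mul_assoc, Units.mul_inv, mul_one]
      _ = D * (↑U⁻¹ : LatticeL2 n →L[ℂ] LatticeL2 n) := by
          rw [← hUs, ← mul_assoc, h1, one_mul]

end Resolvent

/-! ### Growth of the potential and lattice point counts. -/

section Growth

lemma totalDegree_le_natDegree_uniqueAlgEquiv {R σ : Type*} [CommSemiring R] [Unique σ]
    (P : MvPolynomial σ R) :
    P.totalDegree ≤ (MvPolynomial.uniqueAlgEquiv R σ P).natDegree := by
  refine Finset.sup_le fun d hd => ?_
  have h1 : (d.sum fun _ e => e) = d default := by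
    conv_lhs => rw [Finsupp.unique_single d]
    simp
  rw [h1]
  apply Polynomial.le_natDegree_of_ne_zero
  rw [MvPolynomial.coeff_uniqueAlgEquiv, ← Finsupp.unique_single d]
  exact MvPolynomial.mem_support_iff.1 hd

lemma eval_uniqueAlgEquiv {R σ : Type*} [CommSemiring R] [Unique σ] (P : MvPolynomial σ R)
    (x : σ → R) :
    (MvPolynomial.uniqueAlgEquiv R σ P).eval (x default) = MvPolynomial.eval x P := by
  change (MvPolynomial.eval₂ Polynomial.C (fun _ => Polynomial.X) P).eval (x default) = _
  induction P using MvPolynomial.induction_on with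
  | C a => simp
  | add p q hp hq => simp [hp, hq]
  | mul_X p i hp => simp [hp, Unique.eq_default i]

/-- A polynomial of positive degree in one variable is elliptic of order its degree. -/
lemma Polynomial.exists_le_abs_eval (p : Polynomial ℝ) {d : ℕ} (hd : 1 ≤ d)
    (hp : d ≤ p.natDegree) :
    ∃ C > (0 : ℝ), ∃ M > (0 : ℝ), ∀ x : ℝ, M ≤ |x| → C * (1 + |x|) ^ d ≤ |p.eval x| := by
  have hlead : p.leadingCoeff ≠ 0 := by
    rw [Polynomial.leadingCoeff_ne_zero]
    rintro rfl
    simp at hp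
    omega
  obtain ⟨A, hA⟩ := (Polynomial.isEquivalent_cobounded_leading_monomial (P := p)).isBigO_symm.bound
  obtain ⟨M, -, hM⟩ := (Filter.hasBasis_cobounded_norm (E := ℝ)).eventually_iff.1 hA
  set A' := max A 1
  have hA' : 0 < A' := lt_max_of_lt_right one_pos
  refine ⟨|p.leadingCoeff| / (2 ^ p.natDegree * A'), by positivity, max M 1, by positivity,
    fun x hx => ?_⟩
  have h1 : 1 ≤ |x| := (le_max_right _ _).trans hx
  have h2 : ‖p.leadingCoeff * x ^ p.natDegree‖ ≤ A * ‖p.eval x‖ :=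
    hM ((le_max_left _ _).trans hx)
  rw [norm_mul, norm_pow, Real.norm_eq_abs, Real.norm_eq_abs, Real.norm_eq_abs] at h2
  have h3 : (1 + |x|) ^ d ≤ (2 * |x|) ^ p.natDegree :=
    (pow_le_pow_right₀ (by linarith) hp).trans (by gcongr; linarith)
  rw [div_mul_eq_mul_div, div_le_iff₀ (by positivity)]
  calc |p.leadingCoeff| * (1 + |x|) ^ d ≤ |p.leadingCoeff| * (2 * |x|) ^ p.natDegree := by gcongr
    _ = 2 ^ p.natDegree * (|p.leadingCoeff| * |x| ^ p.natDegree) := by rw [mul_pow]; ring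
    _ ≤ 2 ^ p.natDegree * (A' * |p.eval x|) := by
        refine mul_le_mul_of_nonneg_left (h2.trans ?_) (by positivity)
        exact mul_le_mul_of_nonneg_right (le_max_left _ _) (abs_nonneg _)
    _ = |p.eval x| * (2 ^ p.natDegree * A') := by ring

lemma isEllipticPotential_one {hbar : ℝ} {V : MvPolynomial (Fin 1) ℝ}
    (hV : 1 ≤ V.totalDegree) : IsEllipticPotential hbar V V.totalDegree := by
  obtain ⟨C, hC, M, hM, h⟩ := Polynomial.exists_le_abs_eval _ hV
    (totalDegree_le_natDegree_uniqueAlgEquiv V)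
  refine ⟨C, hC, M, hM, fun m hm => ?_⟩
  have hnorm : ‖latticePoint hbar m‖ = |latticePoint hbar m default| := by
    rw [EuclideanSpace.norm_eq, Fin.sum_univ_one, Real.sqrt_sq (norm_nonneg _)]
    rfl
  rw [hnorm] at hm ⊢
  have := h _ hm
  rwa [eval_uniqueAlgEquiv V (fun i => latticePoint hbar m i)] at this

variable {n : ℕ}

lemma norm_le_norm_latticePoint {hbar : ℝ} (hhbar : 0 < hbar) (m : Fin n → ℤ) :
    hbar * ‖m‖ ≤ ‖latticePoint hbar m‖ := by
  rw [← le_div_iff₀' hhbar, pi_norm_le_iff_of_nonneg (by positivity)]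
  intro i
  rw [le_div_iff₀' hhbar]
  calc hbar * ‖m i‖ = ‖latticePoint hbar m i‖ := by
        simp only [latticePoint]
        rw [norm_mul, Real.norm_of_nonneg hhbar.le, Int.norm_eq_abs, Real.norm_eq_abs]
    _ ≤ _ := PiLp.norm_apply_le _ _

/-- The shift K absorbs the ball |k| ≤ M, where only V ≥ 0 is known, so the bound holds at every
site. It is stated in the sup norm on ℤⁿ, which makes boxes easy to count. -/
lemma IsEllipticPotential.exists_growth {hbar : ℝ} (hhbar : 0 < hbar)
    {V : MvPolynomial (Fin n) ℝ} {μ : ℕ} (hV : ∀ m, 0 ≤ potential hbar V m)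
    (h : IsEllipticPotential hbar V μ) :
    ∃ c > (0 : ℝ), ∃ K : ℝ, ∀ m, c * (1 + ‖m‖) ^ μ ≤ potential hbar V m + K := by
  obtain ⟨C, hC, M, hM, h⟩ := h
  set b := min 1 hbar
  have hb : 0 < b := lt_min one_pos hhbar
  have hle : ∀ m : Fin n → ℤ, b * (1 + ‖m‖) ≤ 1 + ‖latticePoint hbar m‖ := by
    intro m
    rw [mul_add, mul_one]
    refine add_le_add (min_le_left _ _) (le_trans ?_ (norm_le_norm_latticePoint hhbar m))
    gcongr
    exact min_le_right _ _
  refine ⟨C * b ^ μ, by positivity, C * (1 + M) ^ μ, fun m => ?_⟩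
  have h1 : C * b ^ μ * (1 + ‖m‖) ^ μ ≤ C * (1 + ‖latticePoint hbar m‖) ^ μ := by
    rw [mul_assoc, ← mul_pow]
    gcongr
    exact hle m
  rcases le_total M ‖latticePoint hbar m‖ with hm | hm
  · have h2 := h m hm
    rw [abs_of_nonneg (hV m)] at h2
    have : 0 ≤ C * (1 + M) ^ μ := by positivity
    linarith
  · have h2 : C * (1 + ‖latticePoint hbar m‖) ^ μ ≤ C * (1 + M) ^ μ := by gcongr
    linarith [hV m]

/-- Comparison with the sum of ‖m‖^(-s) over the standard lattice in ℝⁿ. The origin, where that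
comparison fails, is discarded as a finite set. -/
lemma summable_one_add_norm_rpow {s : ℝ} (hs : n < s) :
    Summable fun m : Fin n → ℤ => (1 + ‖m‖) ^ (-s) := by
  let L := Submodule.span ℤ (Set.range (Pi.basisFun ℝ (Fin n)))
  have hL : -s < -(Module.finrank ℤ L : ℝ) := by
    rw [ZLattice.rank ℝ L]
    simpa using hs
  let φ : (Fin n → ℤ) → L := fun m => ⟨fun i => (m i : ℝ), by
    rw [Module.Basis.mem_span_iff_repr_mem]
    intro i
    exact ⟨m i, by simp⟩⟩
  have hφ : Function.Injective φ := by
    intro m m' h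
    funext i
    have := congrFun (congrArg Subtype.val h) i
    exact Int.cast_injective this
  have hnorm : ∀ m, ‖φ m‖ = ‖m‖ := by
    intro m
    rw [Submodule.coe_norm, Pi.norm_def, Pi.norm_def]
    congr 2
  have h := (ZLattice.summable_norm_rpow L (-s) hL).comp_injective hφ
  refine Summable.of_norm_bounded_eventually h ?_
  filter_upwards [(Set.finite_singleton (0 : Fin n → ℤ)).compl_mem_cofinite] with m hm
  rw [Function.comp_apply, hnorm, Real.norm_of_nonneg (by positivity)]
  refine Real.rpow_le_rpow_of_nonpos (norm_pos_iff.2 hm) (by linarith) ?_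
  have : (0 : ℝ) ≤ n := by positivity
  linarith

variable {W : (Fin n → ℤ) → ℝ} {c K : ℝ} {μ : ℕ}

lemma tendsto_atTop_of_growth (hc : 0 < c) (hμ : 1 ≤ μ)
    (hW : ∀ m, c * (1 + ‖m‖) ^ μ ≤ W m + K) : Filter.Tendsto W Filter.cofinite Filter.atTop := by
  have h1 : Filter.Tendsto (fun m : Fin n → ℤ => ‖m‖) Filter.cofinite Filter.atTop := by
    rw [← Filter.cocompact_eq_cofinite]
    exact tendsto_norm_cocompact_atTop
  refine Filter.tendsto_atTop_mono (f := fun m => c * ‖m‖ + -K) (fun m => ?_)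
    (Filter.tendsto_atTop_add_const_right _ _ (h1.const_mul_atTop hc))
  have h2 : ‖m‖ ≤ (1 + ‖m‖) ^ μ :=
    (by linarith : ‖m‖ ≤ 1 + ‖m‖).trans
      (le_self_pow₀ (by linarith [norm_nonneg m]) (by omega))
  nlinarith [hW m]

lemma finite_setOf_le_of_growth (hc : 0 < c) (hμ : 1 ≤ μ)
    (hW : ∀ m, c * (1 + ‖m‖) ^ μ ≤ W m + K) (E : ℝ) : {m | W m ≤ E}.Finite := by
  have := (tendsto_atTop_of_growth hc hμ hW).eventually (Filter.eventually_gt_atTop E)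
  simpa using this

/-- Counting lattice points in sublevel sets of a function of order `μ`. -/
lemma ncard_setOf_le_of_growth (hn : 1 ≤ n) (hc : 0 < c) (hμ : 1 ≤ μ)
    (hW : ∀ m, c * (1 + ‖m‖) ^ μ ≤ W m + K) {E : ℝ} (hE : {m | W m ≤ E}.Nonempty) :
    c * ({m | W m ≤ E}.ncard : ℝ) ^ ((μ : ℝ) / n) ≤ 3 ^ μ * (E + K) := by
  have hn0 : (n : ℝ) ≠ 0 := by positivity
  have hμ0 : (μ : ℝ) ≠ 0 := by positivity
  set ρ : ℝ := ((E + K) / c) ^ ((1 : ℝ) / μ) with hρ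
  have hpow : ∀ m, W m ≤ E → (1 + ‖m‖) ^ μ ≤ (E + K) / c := by
    intro m hm
    rw [le_div_iff₀ hc]
    linarith [hW m]
  have hmem : ∀ m, W m ≤ E → 1 + ‖m‖ ≤ ρ := by
    intro m hm
    have h0 : 0 ≤ 1 + ‖m‖ := by positivity
    rw [hρ, one_div, Real.le_rpow_inv_iff_of_pos h0 ((by positivity : 0 ≤ (1 + ‖m‖) ^ μ).trans
      (hpow m hm)) (by positivity), Real.rpow_natCast]
    exact hpow m hm
  obtain ⟨m₀, hm₀⟩ := hE
  have hρ1 : 1 ≤ ρ := by linarith [hmem m₀ hm₀, norm_nonneg m₀]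
  have hEK : 0 ≤ (E + K) / c := le_trans (by positivity) (hpow m₀ hm₀)
  have hsub : {m | W m ≤ E} ⊆ (Fintype.piFinset fun _ : Fin n =>
      Finset.Icc (-(⌊ρ⌋₊ : ℤ)) ⌊ρ⌋₊ : Finset (Fin n → ℤ)) := by
    intro m hm
    simp only [Finset.mem_coe, Fintype.mem_piFinset, Finset.mem_Icc, ← abs_le]
    intro i
    have h1 : ‖m i‖ ≤ ρ := (norm_le_pi_norm m i).trans (by linarith [hmem m hm])
    rw [Int.norm_eq_abs, ← Int.cast_abs, Int.abs_eq_natAbs, Int.cast_natCast] at h1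
    rw [Int.abs_eq_natAbs]
    exact_mod_cast Nat.le_floor h1
  -- A box of side 2⌊ρ⌋ + 1 contains the sublevel set. The 3 comes from 2ρ + 1 ≤ 3ρ, valid since
  -- nonemptiness forces ρ ≥ 1.
  have hcard : ({m | W m ≤ E}.ncard : ℝ) ≤ (3 * ρ) ^ n := by
    have h1 := Set.ncard_le_ncard hsub (Finset.finite_toSet _)
    rw [Set.ncard_coe_finset, Fintype.card_piFinset] at h1
    simp only [Int.card_Icc, Finset.prod_const, Finset.card_univ, Fintype.card_fin] at h1
    have h2 : ((⌊ρ⌋₊ : ℤ) + 1 - -(⌊ρ⌋₊ : ℤ)).toNat = 2 * ⌊ρ⌋₊ + 1 := by omega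
    rw [h2] at h1
    calc ({m | W m ≤ E}.ncard : ℝ) ≤ ((2 * ⌊ρ⌋₊ + 1) ^ n : ℕ) := by exact_mod_cast h1
      _ ≤ (3 * ρ) ^ n := by
        push_cast
        gcongr
        linarith [Nat.floor_le (by linarith : 0 ≤ ρ)]
  calc c * ({m | W m ≤ E}.ncard : ℝ) ^ ((μ : ℝ) / n)
      ≤ c * ((3 * ρ) ^ n) ^ ((μ : ℝ) / n) := by gcongr
    _ = c * (3 ^ μ * ρ ^ μ) := by
      rw [← Real.rpow_natCast, ← Real.rpow_mul (by positivity), mul_div_cancel₀ _ hn0,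
        Real.rpow_natCast, mul_pow]
    _ = 3 ^ μ * (E + K) := by
      rw [hρ, ← Real.rpow_natCast (_ ^ _), ← Real.rpow_mul hEK, one_div_mul_cancel hμ0,
        Real.rpow_one]
      field_simp

end Growth

/-! ### Monotone enumeration with multiplicity. -/

/-- A multiset of reals that is infinite and finite below every bound can be enumerated in
nondecreasing order. -/
lemma exists_monotone_enumeration (d : ℝ → ℕ)
    (hfin : ∀ E : ℝ, {p : Σ a : ℝ, Fin (d a) | p.1 ≤ E}.Finite)
    (hinf : Infinite (Σ a : ℝ, Fin (d a))) :
    ∃ ev : ℕ → ℝ, Monotone ev ∧ (∀ a, {j | ev j = a}.encard = d a) ∧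
      ∀ j, j + 1 ≤ {p : Σ a : ℝ, Fin (d a) | p.1 ≤ ev j}.ncard := by
  classical
  -- The lexicographic order breaks ties among copies of one value. With finite initial segments, a
  -- least element and no greatest one, it is order isomorphic to ℕ.
  let S := Σₗ a : ℝ, Fin (d a)
  have hS : Infinite S := hinf
  have hmono : ∀ {p q : S}, p ≤ q → (ofLex p).1 ≤ (ofLex q).1 := by
    intro p q h
    rcases (Sigma.Lex.le_def.1 h) with h | ⟨h, -⟩
    · exact h.le
    · exact h.le
  have hIic : ∀ p : S, (Set.Iic p).Finite := fun p =>
    (hfin (ofLex p).1).subset fun q hq => hmono hq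
  let _ : LocallyFiniteOrder S := LocallyFiniteOrder.ofFiniteIcc fun p q =>
    (hIic q).subset Set.Icc_subset_Iic_self
  have : Nonempty S := inferInstance
  have hmax : NoMaxOrder S := ⟨fun p => by
    by_contra h
    exact Set.infinite_univ ((hIic p).subset fun q _ =>
      Set.mem_Iic.2 (not_lt.1 fun hq => h ⟨q, hq⟩))⟩
  have hbot : ∃ b : S, ∀ p, b ≤ p := by
    obtain ⟨p⟩ := ‹Nonempty S›
    obtain ⟨b, hb, hb'⟩ := Set.exists_min_image (Set.Iic p) id (hIic p) ⟨p, Set.mem_Iic.2 le_rfl⟩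
    refine ⟨b, fun q => ?_⟩
    rcases le_total q p with h | h
    · exact hb' q h
    · exact hb.trans h
  let _ : OrderBot S := { bot := hbot.choose, bot_le := hbot.choose_spec }
  let _ : SuccOrder S := LinearLocallyFiniteOrder.succOrder S
  let _ : PredOrder S := LinearLocallyFiniteOrder.predOrder S
  let e : S ≃o ℕ := orderIsoNatOfLinearSuccPredArch
  let ev : ℕ → ℝ := fun j => (ofLex (e.symm j)).1
  have hev : Monotone ev := fun i j h => hmono (e.symm.monotone h)
  refine ⟨ev, hev, fun a => ?_, fun j => ?_⟩
  · have himg : {j | ev j = a} = Set.range fun i : Fin (d a) => e (toLex ⟨a, i⟩) := by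
      ext j
      constructor
      · intro hj
        obtain ⟨p, rfl⟩ := e.surjective j
        have hp : (ofLex p).1 = a := by simpa [ev] using hj
        subst hp
        exact ⟨(ofLex p).2, rfl⟩
      · rintro ⟨i, rfl⟩
        simp [ev]
    have hinj : Function.Injective fun i : Fin (d a) => e (toLex ⟨a, i⟩) := by
      intro i i' h
      have := toLex.injective (e.injective h)
      simpa using this
    rw [himg, ← Set.image_univ, hinj.encard_image, Set.encard_univ, ENat.card_eq_coe_fintype_card,
      Fintype.card_fin]
  -- The entries of index 0, …, j are j + 1 distinct copies of values at most `ev j`.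
  · have hsub : ((fun i => ofLex (e.symm i)) '' Set.Iic j) ⊆
        {p : Σ a : ℝ, Fin (d a) | p.1 ≤ ev j} := by
      rintro _ ⟨i, hi, rfl⟩
      exact hev hi
    have h1 := Set.ncard_le_ncard hsub (hfin _)
    rw [Set.ncard_image_of_injective _ fun _ _ h => e.symm.injective (ofLex.injective h)] at h1
    have h2 : (Set.Iic j).ncard = j + 1 := by
      rw [← Finset.coe_Iic, Set.ncard_coe_finset, Nat.card_Iic]
    exact h2 ▸ h1

/-! ### Nuclearity and compactness from the diagonal factor. -/

section Nuclear

lemma infinite_lattice {n : ℕ} (hn : 1 ≤ n) : Infinite (Fin n → ℤ) :=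
  have : Nonempty (Fin n) := ⟨⟨0, hn⟩⟩
  Function.infinite_of_right

variable {n : ℕ} {hbar : ℝ} {V : MvPolynomial (Fin n) ℝ}

/-- Multiplication by `(V + λ)⁻¹` followed by any bounded operator is nuclear. -/
lemma isRNuclear_inversePotential_mul (hn : 1 ≤ n) (hV : ∀ m, 0 ≤ potential hbar V m) {lam : ℝ}
    (hlam : 0 < lam) (T : LatticeL2 n →L[ℂ] LatticeL2 n) {r : ℝ} (hr0 : 0 < r) (hr1 : r ≤ 1)
    (hsum : Summable fun m => ((potential hbar V m + lam)⁻¹) ^ r) :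
    IsRNuclear r (inversePotential hV hlam * T) := by
  classical
  have := infinite_lattice hn
  obtain ⟨e⟩ : Nonempty (ℕ ≃ (Fin n → ℤ)) := nonempty_equiv_of_countable
  let a : (Fin n → ℤ) → ℂ := fun m => ((potential hbar V m + lam : ℝ) : ℂ)⁻¹
  have hpos : ∀ m, 0 ≤ (potential hbar V m + lam)⁻¹ := fun m =>
    inv_nonneg.2 (by linarith [hV m])
  have ha : ∀ m, ‖a m‖ = (potential hbar V m + lam)⁻¹ := fun m => by
    simp only [a]
    rw [← Complex.ofReal_inv, Complex.norm_real, Real.norm_of_nonneg (hpos m)]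
  let s : (Fin n → ℤ) → LatticeL2 n := fun m => lp.single 2 m 1
  have hs : ∀ m, ‖s m‖ = 1 := fun m => by simp [s, lp.norm_single]
  -- Row m of the matrix of T. The outer `star` conjugates T⋆δ_m because the nuclear kernel g(k)
  -- h(l) is bilinear, while the inner product conjugates its first argument.
  let h : (Fin n → ℤ) → LatticeL2 n := fun m => star (star T (s m))
  have hh : ∀ m, ‖h m‖ ≤ ‖T‖ := fun m => by
    rw [norm_star]
    refine (ContinuousLinearMap.le_opNorm _ _).trans ?_
    rw [hs, mul_one, ContinuousLinearMap.star_eq_adjoint, LinearIsometryEquiv.norm_map]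
  have hT : ∀ f m, HasSum (fun l => h m l * f l) (T f m) := by
    intro f m
    have h1 : ⟪star T (s m), f⟫ = T f m := by
      rw [ContinuousLinearMap.star_eq_adjoint, ContinuousLinearMap.adjoint_inner_left,
        lp.inner_single_left]
      simp
    rw [← h1]
    refine (lp.hasSum_inner _ _).congr_fun fun l => ?_
    simp only [h, lp.star_apply, RCLike.inner_apply, starRingEnd_apply]
    ring
  refine ⟨hr0, hr1, fun j => a (e j) • s (e j), fun j => h (e j), ?_, fun f k => ?_⟩
  · refine Summable.of_nonneg_of_le (fun j => by positivity) (fun j => ?_)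
      ((e.summable_iff.2 hsum).mul_right (‖T‖ ^ r))
    rw [norm_smul, hs, mul_one, ha]
    refine mul_le_mul_of_nonneg_left (Real.rpow_le_rpow (norm_nonneg _) (hh _) hr0.le)
      (Real.rpow_nonneg (hpos _) _)
  · have hker : ∀ l, ∑' j, (a (e j) • s (e j)) k * h (e j) l = a k * h k l := by
      intro l
      rw [e.tsum_eq (fun m => (a m • s m) k * h m l), tsum_eq_single k]
      · simp [s]
      · intro m hm
        simp [s, Pi.single_eq_of_ne hm.symm]
    simp only [hker, mul_assoc]
    exact (hT f k).mul_left (a k)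

lemma isCompactOperator_inversePotential_mul (hV : ∀ m, 0 ≤ potential hbar V m) {lam : ℝ}
    (hlam : 0 < lam) (T : LatticeL2 n →L[ℂ] LatticeL2 n)
    (htend : Filter.Tendsto (potential hbar V) Filter.cofinite Filter.atTop) :
    IsCompactOperator (inversePotential hV hlam * T) := by
  suffices h : IsCompactOperator (inversePotential hV hlam) from h.comp_clm T
  refine isCompactOperator_lpMul ?_
  have h1 := (Filter.tendsto_atTop_add_const_right _ lam htend).inv_tendsto_atTop
  have h2 := (Complex.continuous_ofReal.tendsto 0).comp h1
  rw [Complex.ofReal_zero] at h2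
  refine h2.congr fun m => ?_
  simp

end Nuclear

/-! ### Eigenvalues of H through its resolvent. -/

section Eigenvalues

variable {n : ℕ} {hbar : ℝ} {V : MvPolynomial (Fin n) ℝ}

lemma mem_unboundedEigenspace {H : LatticeL2 n →ₗ.[ℂ] LatticeL2 n} {z : ℂ} {u : H.domain} :
    u ∈ unboundedEigenspace H z ↔ H u = z • (u : LatticeL2 n) := by
  rw [unboundedEigenspace, LinearMap.mem_ker, LinearMap.sub_apply, sub_eq_zero]
  rfl

lemma finrank_map_unboundedEigenspace (H : LatticeL2 n →ₗ.[ℂ] LatticeL2 n) (z : ℂ) :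
    Module.finrank ℂ ((unboundedEigenspace H z).map H.domain.subtype) =
      Module.finrank ℂ (unboundedEigenspace H z) :=
  (Submodule.equivMapOfInjective _ H.domain.injective_subtype _).finrank_eq.symm

/-- The eigenspaces of `H` are those of its resolvent. For `z = -λ` both sides vanish. -/
lemma IsShiftedInverse.map_unboundedEigenspace {H : LatticeL2 n →ₗ.[ℂ] LatticeL2 n} {w : ℂ}
    {R : LatticeL2 n →L[ℂ] LatticeL2 n} (hR : IsShiftedInverse H w R) (z : ℂ) :
    (unboundedEigenspace H z).map H.domain.subtype =
      Module.End.eigenspace (R : Module.End ℂ (LatticeL2 n)) (z + w)⁻¹ := by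
  ext x
  rw [Module.End.mem_eigenspace_iff, Submodule.mem_map]
  constructor
  · rintro ⟨u, hu, rfl⟩
    rw [mem_unboundedEigenspace] at hu
    have h := hR.2 u
    rw [hu, ← add_smul, map_smul] at h
    rcases eq_or_ne (z + w) 0 with h0 | h0
    · rw [h0, zero_smul] at h
      simp [← h]
    · change R u = (z + w)⁻¹ • (u : LatticeL2 n)
      rw [eq_inv_smul_iff₀ h0, h]
  · intro hx
    obtain ⟨u, hu, hux⟩ := hR.1 x
    change R x = _ at hx
    rcases eq_or_ne (z + w) 0 with h0 | h0
    · rw [hx, h0, inv_zero, zero_smul] at hu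
      have hu0 : u = 0 := Subtype.ext hu
      refine ⟨0, Submodule.zero_mem _, ?_⟩
      rw [← hux, hu0]
      simp
    · refine ⟨(z + w) • u, Submodule.smul_mem _ _ (mem_unboundedEigenspace.2 ?_), ?_⟩
      · rw [hx, eq_inv_smul_iff₀ h0] at hu
        rw [← hu, add_smul] at hux
        exact add_right_cancel hux
      · rw [map_smul]
        change (z + w) • (u : LatticeL2 n) = x
        rw [hu, hx, smul_inv_smul₀ h0]

lemma formalSchrodinger_of_mem_map {z : ℂ} {x : LatticeL2 n}
    (hx : x ∈ (unboundedEigenspace (schrodinger hbar V) z).map (schrodinger hbar V).domain.subtype)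
    (m : Fin n → ℤ) : formalSchrodinger hbar V x m = z * x m := by
  obtain ⟨u, hu, rfl⟩ := hx
  rw [SetLike.mem_coe, mem_unboundedEigenspace] at hu
  exact congrArg (fun g : LatticeL2 n => g m) hu

/-- The eigenvalue counting function of `H` is bounded by the counting function of `V`. -/
lemma ncard_eigenvalue_le {α : Type*} {v : α → LatticeL2 n} (hv : Orthonormal ℂ v) {ev : α → ℝ}
    (hev : ∀ p m, formalSchrodinger hbar V (v p) m = ev p * v p m) {E : ℝ}
    (hfin : {m | potential hbar V m ≤ E}.Finite) :
    {p | ev p ≤ E}.Finite ∧ {p | ev p ≤ E}.ncard ≤ {m | potential hbar V m ≤ E}.ncard := by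
  classical
  let N := {m | potential hbar V m ≤ E}
  have : Fintype N := hfin.fintype
  -- Restrict the eigenvectors with eigenvalue at most E to the finite set {V ≤ E}. Independence of
  -- these restrictions gives the count.
  let w : {p | ev p ≤ E} → (N → ℂ) := fun p m => v p m
  have hw : LinearIndependent ℂ w := by
    rw [linearIndependent_iff']
    intro s c hc
    have hv' := hv.comp (Subtype.val : {p | ev p ≤ E} → α) Subtype.val_injective
    refine linearIndependent_iff'.1 hv'.linearIndependent s c ?_
    -- A combination vanishing on {V ≤ E} has energy at most E‖x‖² by orthonormality, hence is zero.
    refine eq_zero_of_re_inner_le hbar (W := potential hbar V) (E := E)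
      (y := ∑ p ∈ s, (c p * ev p) • (v ∘ Subtype.val) p) (fun m => ?_) (fun m hm => ?_) ?_
    · rw [← formalSchrodinger_apply, lp.coeFn_sum, lp.coeFn_sum, map_sum, Finset.sum_apply,
        Finset.sum_apply]
      refine Finset.sum_congr rfl fun p _ => ?_
      rw [lp.coeFn_smul, lp.coeFn_smul, map_smul, Pi.smul_apply, Pi.smul_apply, Function.comp_apply,
        hev, smul_eq_mul, smul_eq_mul, mul_assoc]
    · have := congrFun hc ⟨m, hm⟩
      rw [Finset.sum_apply] at this
      rw [lp.coeFn_sum, Finset.sum_apply]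
      exact this
    · have h1 : ‖∑ p ∈ s, c p • (v ∘ Subtype.val) p‖ ^ 2 = ∑ p ∈ s, ‖c p‖ ^ 2 := by
        rw [← inner_self_eq_norm_sq (𝕜 := ℂ), hv'.inner_sum, map_sum]
        refine Finset.sum_congr rfl fun p _ => ?_
        rw [Complex.conj_mul', ← Complex.ofReal_pow]
        exact Complex.ofReal_re _
      rw [h1, hv'.inner_sum, Complex.re_sum, Finset.mul_sum]
      refine Finset.sum_le_sum fun p _ => ?_
      rw [← mul_assoc, Complex.conj_mul', ← Complex.ofReal_pow, ← Complex.ofReal_mul,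
        Complex.ofReal_re, mul_comm]
      exact mul_le_mul_of_nonneg_right p.2 (by positivity)
  have hf : Finite {p | ev p ≤ E} := hw.finite
  refine ⟨hf, ?_⟩
  have : Fintype {p | ev p ≤ E} := Fintype.ofFinite _
  have hcard := hw.fintype_card_le_finrank
  rw [Module.finrank_fintype_fun_eq_card, ← Nat.card_eq_fintype_card,
    ← Nat.card_eq_fintype_card] at hcard
  exact hcard

section Compact

variable {E : Type*} [NormedAddCommGroup E] [InnerProductSpace ℂ E] {R : E →L[ℂ] E}

lemma ofReal_re_of_eigenspace_ne_bot (hsymm : R.IsSymmetric) {ν : ℂ}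
    (hν : Module.End.eigenspace (R : Module.End ℂ E) ν ≠ ⊥) : (ν.re : ℂ) = ν :=
  Complex.conj_eq_iff_re.1 (hsymm.conj_eigenvalue_eq_self hν)

variable [CompleteSpace E]

/-- An injective compact operator has finite-dimensional eigenspaces. -/
lemma finiteDimensional_eigenspace_of_injective (hR : IsCompactOperator R)
    (h0 : Module.End.eigenspace (R : Module.End ℂ E) 0 = ⊥) (ν : ℂ) :
    FiniteDimensional ℂ (Module.End.eigenspace (R : Module.End ℂ E) ν) := by
  rcases eq_or_ne ν 0 with rfl | hν
  · rw [h0]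
    infer_instance
  · exact ContinuousLinearMap.finite_dimensional_eigenspace hR ν hν

/-- An injective compact self-adjoint operator on an infinite-dimensional Hilbert space has an
infinite orthonormal family of eigenvectors, adapted to all its eigenspaces. The eigenvalues are
parametrized as `(a + lam)⁻¹`. -/
lemma exists_orthonormal_eigenvectors (hR : IsCompactOperator R) (hsymm : R.IsSymmetric)
    (h0 : Module.End.eigenspace (R : Module.End ℂ E) 0 = ⊥) (hE : ¬ FiniteDimensional ℂ E)
    (lam : ℝ) (d : ℝ → ℕ)
    (hd : ∀ a : ℝ, d a =
      Module.finrank ℂ (Module.End.eigenspace (R : Module.End ℂ E) ((a : ℂ) + lam)⁻¹)) :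
    Infinite (Σ a : ℝ, Fin (d a)) ∧ ∃ v : (Σ a : ℝ, Fin (d a)) → E, Orthonormal ℂ v ∧
      ∀ p, v p ∈ Module.End.eigenspace (R : Module.End ℂ E) ((p.1 : ℂ) + lam)⁻¹ := by
  have hfd := finiteDimensional_eigenspace_of_injective hR h0
  let b : ∀ a : ℝ, OrthonormalBasis (Fin (d a)) ℂ
      (Module.End.eigenspace (R : Module.End ℂ E) ((a : ℂ) + lam)⁻¹) := fun a =>
    (stdOrthonormalBasis ℂ _).reindex (finCongr (hd a).symm)
  -- Inversion is injective on all of ℂ with 0⁻¹ = 0, so a = -λ needs no exclusion.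
  have hinj : Function.Injective fun a : ℝ => ((a : ℂ) + lam)⁻¹ := fun a b h => by
    simpa using h
  have hortho := hsymm.orthogonalFamily_eigenspaces.comp hinj
  let v : (Σ a : ℝ, Fin (d a)) → E := fun p => b p.1 p.2
  have hv : Orthonormal ℂ v := hortho.orthonormal_sigma_orthonormal fun a => (b a).orthonormal
  refine ⟨?_, v, hv, fun p => (b p.1 p.2).2⟩
  have hle : ∀ ν, Module.End.eigenspace (R : Module.End ℂ E) ν ≤
      Submodule.span ℂ (Set.range v) := by
    intro ν
    by_cases hν : Module.End.eigenspace (R : Module.End ℂ E) ν = ⊥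
    · rw [hν]
      exact bot_le
    · have hνa : (((ν.re⁻¹ - lam : ℝ) : ℂ) + lam)⁻¹ = ν := by
        push_cast
        rw [sub_add_cancel, inv_inv, ofReal_re_of_eigenspace_ne_bot hsymm hν]
      rw [← hνa]
      intro x hx
      have h1 := congrArg Subtype.val ((b (ν.re⁻¹ - lam)).sum_repr ⟨x, hx⟩)
      change _ = x at h1
      rw [← h1, Submodule.coe_sum]
      exact Submodule.sum_mem _ fun i _ => Submodule.smul_mem _ _
        (Submodule.subset_span ⟨⟨_, i⟩, rfl⟩)
  rw [← not_finite_iff_infinite]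
  intro hf
  have hspan : FiniteDimensional ℂ (Submodule.span ℂ (Set.range v)) :=
    FiniteDimensional.span_of_finite ℂ (Set.finite_range v)
  -- If the family were finite, its span would be closed and contain every eigenspace, so by the
  -- spectral theorem it would be all of E.
  have horth : (Submodule.span ℂ (Set.range v))ᗮ = ⊥ := by
    rw [eq_bot_iff, ← ContinuousLinearMap.orthogonalComplement_iSup_eigenspaces_eq_bot hR hsymm]
    exact Submodule.orthogonal_le (iSup_le hle)
  rw [Submodule.orthogonal_eq_bot_iff] at horth
  rw [horth] at hspan
  exact hE (Submodule.topEquiv.finiteDimensional)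

end Compact

lemma not_finiteDimensional_latticeL2 (hn : 1 ≤ n) : ¬ FiniteDimensional ℂ (LatticeL2 n) := by
  intro h
  have hbasis := (default : HilbertBasis (Fin n → ℤ) ℂ (LatticeL2 n)).orthonormal
  have := infinite_lattice hn
  exact not_finite_iff_infinite.2 this hbasis.linearIndependent.finite

lemma IsShiftedInverse.eigenspace_zero {H : LatticeL2 n →ₗ.[ℂ] LatticeL2 n} {w : ℂ}
    {R : LatticeL2 n →L[ℂ] LatticeL2 n} (hR : IsShiftedInverse H w R) :
    Module.End.eigenspace (R : Module.End ℂ (LatticeL2 n)) 0 = ⊥ := by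
  rw [Submodule.eq_bot_iff]
  intro x hx
  rw [Module.End.mem_eigenspace_iff, zero_smul] at hx
  obtain ⟨u, hu, hux⟩ := hR.1 x
  have hu0 : u = 0 := Subtype.ext (hu.trans hx)
  rw [← hux, hu0]
  simp

lemma exists_isEigenvalueEnumeration (hn : 1 ≤ n) {lam : ℝ} {R : LatticeL2 n →L[ℂ] LatticeL2 n}
    (hR : IsShiftedInverse (schrodinger hbar V) lam R) (hsymm : R.IsSymmetric)
    (hcomp : IsCompactOperator R) (hfin : ∀ E, {m | potential hbar V m ≤ E}.Finite) :
    ∃ ev : ℕ → ℝ, IsEigenvalueEnumeration (schrodinger hbar V) ev ∧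
      ∀ j, j + 1 ≤ {m | potential hbar V m ≤ ev j}.ncard := by
  have hfd := finiteDimensional_eigenspace_of_injective hcomp hR.eigenspace_zero
  obtain ⟨hinf, v, hv, hmem⟩ := exists_orthonormal_eigenvectors hcomp hsymm hR.eigenspace_zero
    (not_finiteDimensional_latticeL2 hn) lam _ fun a => rfl
  have hev : ∀ p m, formalSchrodinger hbar V (v p) m = (p.1 : ℝ) * v p m := fun p m =>
    formalSchrodinger_of_mem_map ((hR.map_unboundedEigenspace p.1).symm ▸ hmem p) m
  have hcount := fun E => ncard_eigenvalue_le hv hev (hfin E)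
  obtain ⟨ev, hmono, henc, hnc⟩ := exists_monotone_enumeration _ (fun E => (hcount E).1) hinf
  refine ⟨ev, ⟨hmono, fun z => ?_⟩, fun j => (hnc j).trans (hcount _).2⟩
  have hmap := hR.map_unboundedEigenspace z
  constructor
  · have := hfd (z + lam)⁻¹
    rw [← hmap] at this
    exact (Submodule.equivMapOfInjective _ (schrodinger hbar V).domain.injective_subtype
      _).symm.finiteDimensional
  · rw [← finrank_map_unboundedEigenspace, hmap]
    by_cases hz : (z.re : ℂ) = z
    · rw [← hz]
      simpa only [Complex.ofReal_inj] using henc z.re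
    -- For nonreal z both counts are zero: the eigenvalues of the symmetric R are real.
    · have hbot : Module.End.eigenspace (R : Module.End ℂ (LatticeL2 n)) (z + lam)⁻¹ = ⊥ := by
        by_contra hne
        have h1 := ofReal_re_of_eigenspace_ne_bot hsymm hne
        apply hz
        rw [← Complex.conj_eq_iff_re] at h1 ⊢
        simpa using h1
      have hempty : {j | (ev j : ℂ) = z} = ∅ := by
        rw [Set.eq_empty_iff_forall_notMem]
        rintro j rfl
        exact hz (by simp)
      rw [hbot, hempty]
      simp

end Eigenvalues

/-! ### Summability and eigenvalue growth. -/

section Main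

variable {n : ℕ} {W : (Fin n → ℤ) → ℝ} {c K : ℝ} {μ : ℕ}

lemma summable_inv_rpow_of_growth (hc : 0 < c) (hW : ∀ m, c * (1 + ‖m‖) ^ μ ≤ W m + K) {r : ℝ}
    (hr0 : 0 < r) (hr : n < μ * r) : Summable fun m => ((W m + K)⁻¹) ^ r := by
  have hpos : ∀ m, 0 < W m + K := fun m => lt_of_lt_of_le (by positivity) (hW m)
  refine Summable.of_nonneg_of_le (fun m => Real.rpow_nonneg (inv_nonneg.2 (hpos m).le) r)
    (fun m => ?_) ((summable_one_add_norm_rpow hr).mul_left ((c⁻¹) ^ r))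
  have h1 : (W m + K)⁻¹ ≤ c⁻¹ * (1 + ‖m‖) ^ (-(μ : ℝ)) := by
    rw [Real.rpow_neg (by positivity), Real.rpow_natCast, ← mul_inv]
    exact inv_anti₀ (by positivity) (hW m)
  calc ((W m + K)⁻¹) ^ r ≤ (c⁻¹ * (1 + ‖m‖) ^ (-(μ : ℝ))) ^ r :=
        Real.rpow_le_rpow (inv_nonneg.2 (hpos m).le) h1 hr0.le
    _ = (c⁻¹) ^ r * (1 + ‖m‖) ^ (-(μ * r)) := by
        rw [Real.mul_rpow (by positivity) (by positivity), ← Real.rpow_mul (by positivity),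
          neg_mul]

/-- A sequence whose counting function is bounded by that of a function of order `μ` on `ℤⁿ` grows
at least like `j ^ (μ / n)`. -/
lemma eventually_le_of_growth (hn : 1 ≤ n) (hc : 0 < c) (hμ : 1 ≤ μ)
    (hW : ∀ m, c * (1 + ‖m‖) ^ μ ≤ W m + K) {ev : ℕ → ℝ}
    (hev : ∀ j, j + 1 ≤ {m | W m ≤ ev j}.ncard) {s : ℝ} (hs : s ≤ μ / n) :
    ∃ C : ℝ, 0 < C ∧ ∀ᶠ j : ℕ in Filter.atTop, C * ((j : ℝ) + 1) ^ s ≤ ev j := by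
  have hpos : (0 : ℝ) < μ / n := by positivity
  -- Counting gives c/3^μ · (j + 1)^(μ/n) ≤ `ev j` + K; half of the left side eventually exceeds K
  -- and absorbs it.
  refine ⟨c / 3 ^ μ / 2, by positivity, ?_⟩
  have htend : Filter.Tendsto (fun j : ℕ => c / 3 ^ μ / 2 * ((j : ℝ) + 1) ^ ((μ : ℝ) / n))
      Filter.atTop Filter.atTop :=
    ((tendsto_rpow_atTop hpos).comp (Filter.tendsto_atTop_add_const_right _ 1
      tendsto_natCast_atTop_atTop)).const_mul_atTop (by positivity)
  filter_upwards [htend.eventually_ge_atTop K] with j hj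
  have hne : {m | W m ≤ ev j}.Nonempty := Set.nonempty_of_ncard_ne_zero (by have := hev j; omega)
  have h1 := ncard_setOf_le_of_growth hn hc hμ hW hne
  have h2 : c * ((j : ℝ) + 1) ^ ((μ : ℝ) / n) ≤ 3 ^ μ * (ev j + K) := by
    refine le_trans ?_ h1
    gcongr
    exact_mod_cast hev j
  have h3 : c / 3 ^ μ * ((j : ℝ) + 1) ^ ((μ : ℝ) / n) ≤ ev j + K := by
    rw [div_mul_eq_mul_div, div_le_iff₀ (by positivity)]
    linarith
  have h4 : c / 3 ^ μ / 2 * ((j : ℝ) + 1) ^ s ≤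
      c / 3 ^ μ / 2 * ((j : ℝ) + 1) ^ ((μ : ℝ) / n) := by
    gcongr
    linarith [(Nat.cast_nonneg j : (0 : ℝ) ≤ j)]
  linarith

end Main

end

theorem mainTheorem1 (n : ℕ) (hn : 1 ≤ n) (hbar : ℝ) (hhbar : 0 < hbar)
    (V : MvPolynomial (Fin n) ℝ) (μ : ℕ) (hμ : 1 ≤ μ) (hdeg : V.totalDegree = μ)
    (hnonneg : ∀ m : Fin n → ℤ, 0 ≤ potential hbar V m)
    (hell : 2 ≤ n → IsEllipticPotential hbar V μ) :
    (∃ lam : ℝ, 0 < lam ∧ ∃ R : LatticeL2 n →L[ℂ] LatticeL2 n,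
      IsShiftedInverse (schrodinger hbar V) (lam : ℂ) R ∧
      ∀ r : ℝ, (n : ℝ) / (μ : ℝ) < r → r ≤ 1 → IsRNuclear r R) ∧
    (∃ ev : ℕ → ℝ, IsEigenvalueEnumeration (schrodinger hbar V) ev ∧
      ∀ r : ℝ, (n : ℝ) / (μ : ℝ) < r → r ≤ 1 →
        ∃ C : ℝ, 0 < C ∧ ∀ᶠ j : ℕ in Filter.atTop,
          C * ((j : ℝ) + 1) ^ (1 / r) ≤ ev j) := by
  have hell' : IsEllipticPotential hbar V μ := by
    rcases hn.lt_or_eq with h | rfl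
    · exact hell h
    · subst hdeg
      exact isEllipticPotential_one hμ
  obtain ⟨c, hc, K, hK⟩ := hell'.exists_growth hhbar hnonneg
  -- Beyond ‖B‖ for the Neumann series, and at least K so that V + λ itself has growth of order μ.
  set lam := max K (‖kinetic n hbar‖ + 1)
  have hB : ‖kinetic n hbar‖ < lam := lt_max_of_lt_right (lt_add_one _)
  have hlam : 0 < lam := (norm_nonneg _).trans_lt hB
  have hgrowth : ∀ m, c * (1 + ‖m‖) ^ μ ≤ potential hbar V m + lam := fun m =>
    (hK m).trans (by linarith [le_max_left K (‖kinetic n hbar‖ + 1)])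
  obtain ⟨T, hR, hsymm⟩ := exists_isShiftedInverse hnonneg hlam hB
  have hr0 : ∀ r : ℝ, (n : ℝ) / μ < r → 0 < r := fun r hr => lt_of_le_of_lt (by positivity) hr
  have hμ0 : (0 : ℝ) < μ := by positivity
  refine ⟨⟨lam, hlam, _, hR, fun r hr hr1 => ?_⟩, ?_⟩
  · refine isRNuclear_inversePotential_mul hn hnonneg hlam T (hr0 r hr) hr1
      (summable_inv_rpow_of_growth hc hgrowth (hr0 r hr) ?_)
    rwa [div_lt_iff₀' hμ0] at hr
  · obtain ⟨ev, hev, hcount⟩ := exists_isEigenvalueEnumeration hn hR hsymm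
      (isCompactOperator_inversePotential_mul hnonneg hlam T
        (tendsto_atTop_of_growth hc hμ hgrowth)) (finite_setOf_le_of_growth hc hμ hgrowth)
    refine ⟨ev, hev, fun r hr _ => eventually_le_of_growth hn hc hμ hgrowth hcount ?_⟩
    rw [div_le_div_iff₀ (hr0 r hr) (by positivity), one_mul]
    rw [div_lt_iff₀' hμ0] at hr
    exact hr.le
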